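/- Let $D$ be an integral domain with quotient field $K$. For a nonzero $D$-submodule $E$ of $K$ put $E^{-1}=\{x\in K : xE\subseteq D\}$ and $E^{v}=(E^{-1})^{-1}$. For a nonzero fractional ideal $E$ of $D$ put $E^{t}=\bigcup\{F^{v} : F\subseteq E \text{ a nonzero finitely generated } D\text{-submodule}\}$. A nonzero ideal $I$ of $D$ is divisorial if $I^{v}=I$ and is a $t$-ideal if $I^{t}=I$; a $t$-prime is a prime $t$-ideal, and a $t$-maximal ideal is an ideal that is maximal in the set of proper $t$-ideals. The domain $D$ is a Prüfer $v$-multiplication domain (P$v$MD) if $(II^{-1})^{t}=D$ for every nonzero finitely generated ideal $I$ of $D$. A $t$-prime $P$ is $t$-sharp if $\bigcap\{D_M : M \text{ is } t\text{-maximal and } P\nsubseteq M\}\nsubseteq D_P$ (localizations are taken inside $K$, and an empty intersection is $K$), and $D$ is $t$-doublesharp if every $t$-prime of $D$ is $t$-sharp. If $D$ is a $t$-doublesharp P$v$MD and $P$ is a $t$-prime of $D$ that is not $t$-maximal, then $P$ is divisorial. -/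

import Mathlib

namespace TOperation

variable {D : Type*} [CommRing D] {K : Type*} [Field K] [Algebra D K]

/-- `E ^ v = (E⁻¹)⁻¹` for a `D`-submodule `E` of `K`, where `E⁻¹ = 1 / E` is the
submodule `{x ∈ K | x E ⊆ D}` (the unit submodule `1` is the image of `D` in `K`). -/
def vClosure (E : Submodule D K) : Submodule D K :=
  1 / (1 / E)

/-- `E ^ t` is the union (see `mem_tClosure_iff`) of the `F ^ v`, where `F` ranges over the nonzero
finitely generated `D`-submodules of `E`. -/
def tClosure (E : Submodule D K) : Submodule D K :=
  ⨆ F : {F : Submodule D K // F ≠ ⊥ ∧ F.FG ∧ F ≤ E}, vClosure F.1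

theorem vClosure_mono {E F : Submodule D K} (h : E ≤ F) :
    vClosure E ≤ vClosure F := by
  intro x hx
  rw [vClosure, Submodule.mem_div_iff_forall_mul_mem] at hx ⊢
  intro y hy
  refine hx y ?_
  rw [Submodule.mem_div_iff_forall_mul_mem] at hy ⊢
  exact fun z hz => hy z (h hz)

theorem mem_tClosure_iff {E : Submodule D K} (hE : E ≠ ⊥)
    (x : K) :
    x ∈ tClosure E ↔ ∃ F : Submodule D K, F ≠ ⊥ ∧ F.FG ∧ F ≤ E ∧ x ∈ vClosure F := by
  obtain ⟨e, he, he0⟩ := Submodule.exists_mem_ne_zero_of_ne_bot hE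
  have : Nonempty {F : Submodule D K // F ≠ ⊥ ∧ F.FG ∧ F ≤ E} :=
    ⟨⟨Submodule.span D {e}, by simpa using he0, Submodule.fg_span_singleton e,
      by simpa [Submodule.span_le] using he⟩⟩
  rw [tClosure, Submodule.mem_iSup_of_directed]
  · constructor
    · rintro ⟨⟨F, h0, h1, h2⟩, hx⟩
      exact ⟨F, h0, h1, h2, hx⟩
    · rintro ⟨F, h0, h1, h2, hx⟩
      exact ⟨⟨F, h0, h1, h2⟩, hx⟩
  · rintro ⟨F, h0, h1, h2⟩ ⟨G, g0, g1, g2⟩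
    exact ⟨⟨F ⊔ G, fun h => h0 (le_bot_iff.1 (h ▸ le_sup_left)), h1.sup g1, sup_le h2 g2⟩,
      vClosure_mono le_sup_left, vClosure_mono le_sup_right⟩

variable (K)

/-- A divisorial ideal: a nonzero ideal `I` of `D`, regarded inside `K`, with `I ^ v = I`. -/
def IsDivisorial (I : Ideal D) : Prop :=
  I ≠ ⊥ ∧ vClosure (IsLocalization.coeSubmodule K I) = IsLocalization.coeSubmodule K I

/-- A `t`-ideal: a nonzero ideal `I` with `I ^ t = I`. -/
def IsTIdeal (I : Ideal D) : Prop :=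
  I ≠ ⊥ ∧ tClosure (IsLocalization.coeSubmodule K I) = IsLocalization.coeSubmodule K I

/-- A `t`-prime: a prime `t`-ideal. -/
def IsTPrime (P : Ideal D) : Prop :=
  P.IsPrime ∧ IsTIdeal K P

/-- A `t`-maximal ideal: an ideal maximal among the proper `t`-ideals. -/
def IsTMaximal (M : Ideal D) : Prop :=
  Maximal (fun I : Ideal D => I ≠ ⊤ ∧ IsTIdeal K I) M

/-- A domain is a Prüfer `v`-multiplication domain if every nonzero finitely generated ideal `I`
is `t`-invertible, i.e. `(I I⁻¹) ^ t = D`. -/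
def IsPvMD (D : Type*) [CommRing D] (K : Type*) [Field K] [Algebra D K] : Prop :=
  ∀ I : Ideal D, I ≠ ⊥ → I.FG →
    tClosure (IsLocalization.coeSubmodule K I * (1 / IsLocalization.coeSubmodule K I)) = 1

/-- The localization `D_P`, as the set of fractions `a / s` in `K` with `s ∉ P`. -/
def localizationAt (P : Ideal D) : Set K :=
  {x | ∃ a s : D, s ∉ P ∧ x = algebraMap D K a / algebraMap D K s}

/-- For a prime `P`, the set `localizationAt K P` is Mathlib's localization of `D` at `P`
inside `K`. -/
theorem localizationAt_eq [IsDomain D] [IsFractionRing D K] (P : Ideal D) [hP : P.IsPrime] :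
    localizationAt K P =
      (Localization.subalgebra.ofField K P.primeCompl P.primeCompl_le_nonZeroDivisors : Set K) := by
  ext x
  constructor
  · rintro ⟨a, s, hs, rfl⟩
    exact ⟨a, s, hs, div_eq_mul_inv _ _⟩
  · rintro ⟨a, s, hs, rfl⟩
    exact ⟨a, s, hs, (div_eq_mul_inv _ _).symm⟩

/-- `Θ ^ t (P)`: the intersection in `K` of the `D_M`, where `M` ranges over the `t`-maximal ideals
not containing `P` (it is `K` if there are none). -/
def tTheta (P : Ideal D) : Set K :=
  ⋂ M ∈ {M : Ideal D | IsTMaximal K M ∧ ¬ P ≤ M}, localizationAt K M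

/-- `P` is `t`-sharp if `Θ ^ t (P) ⊈ D_P`. -/
def IsTSharp (P : Ideal D) : Prop :=
  ¬ tTheta K P ⊆ localizationAt K P

/-- `D` is `t`-doublesharp if every `t`-prime of `D` is `t`-sharp. -/
def IsTDoublesharp (D : Type*) [CommRing D] (K : Type*) [Field K] [Algebra D K] : Prop :=
  ∀ P : Ideal D, IsTPrime K P → IsTSharp K P

end TOperation

/-!
Let `P < M` be `t`-primes and suppose `x ∈ M \ P` lay in `P ^ v`. Choose a prime `Q ≤ M` minimal
over `P + (x)`; it is a `t`-prime, because in a PvMD every nonzero prime below a `t`-prime is one.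
Sharpness of `Q` yields a finitely generated ideal `J` with `x ∈ J ≤ Q` such that the `t`-maximal
ideals containing `J` all contain `Q`. Since `J` is `t`-invertible, some `u ∈ J⁻¹` and `g ∈ J`
satisfy `g u ∉ Q`. Such a `u` lies in `D_P` and in `D_N` for each `t`-maximal `N` not containing
`P`, so all of its powers lie in `P⁻¹`, and hence `uⁿ (P + (x)) ⊆ D` for every `n`. But `D_Q` is a
valuation domain in which `u⁻¹` is a nonunit, so the elements `d` with `uⁿ d ∈ D_Q` for all `n` form
a prime, which lies between `P + (x)` and `Q`. Thus it is `Q`, yet it does not contain `g`.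
-/

namespace TOperation

open IsLocalization (coeSubmodule)

variable {D : Type*} [CommRing D] {K : Type*} [Field K] [Algebra D K]

theorem le_vClosure (E : Submodule D K) : E ≤ vClosure E := by
  rw [vClosure, Submodule.le_div_iff_mul_le]
  exact Submodule.mul_one_div_le_one

theorem mul_one_div_mul_le (E F : Submodule D K) : E * (1 / (E * F)) ≤ 1 / F := by
  rw [Submodule.le_div_iff_mul_le, mul_right_comm]
  exact Submodule.mul_one_div_le_one

theorem mul_vClosure_le (E F : Submodule D K) : E * vClosure F ≤ vClosure (E * F) := by
  rw [vClosure, vClosure, Submodule.le_div_iff_mul_le, mul_right_comm]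
  calc E * (1 / (E * F)) * (1 / (1 / F)) ≤ 1 / F * (1 / (1 / F)) :=
        mul_le_mul_left (mul_one_div_mul_le E F) _
    _ ≤ 1 := Submodule.mul_one_div_le_one

theorem one_div_le_one {E : Submodule D K} (hE : (1 : K) ∈ E) : 1 / E ≤ 1 := fun x hx => by
  simpa only [mul_one] using Submodule.mem_div_iff_forall_mul_mem.1 hx 1 hE

theorem vClosure_one : vClosure (1 : Submodule D K) = 1 := by
  refine le_antisymm (one_div_le_one ?_) (le_vClosure 1)
  exact Submodule.mem_div_iff_forall_mul_mem.2 fun y hy => by rwa [one_mul]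

theorem vClosure_le_tClosure {E F : Submodule D K} (h0 : F ≠ ⊥) (hF : F.FG) (hFE : F ≤ E) :
    vClosure F ≤ tClosure E :=
  le_iSup (fun G : {G : Submodule D K // G ≠ ⊥ ∧ G.FG ∧ G ≤ E} => vClosure G.1) ⟨F, h0, hF, hFE⟩

theorem le_tClosure (E : Submodule D K) : E ≤ tClosure E := fun x hx => by
  obtain rfl | hx0 := eq_or_ne x 0
  · exact zero_mem _
  · exact vClosure_le_tClosure (by rwa [Ne, Submodule.span_singleton_eq_bot])
      (Submodule.fg_span_singleton x) ((Submodule.span_singleton_le_iff_mem _ _).2 hx)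
      (le_vClosure _ (Submodule.mem_span_singleton_self x))

theorem tClosure_mono {E F : Submodule D K} (h : E ≤ F) : tClosure E ≤ tClosure F :=
  iSup_le fun G => vClosure_le_tClosure G.2.1 G.2.2.1 (G.2.2.2.trans h)

theorem tClosure_eq_self_iff {E : Submodule D K} :
    tClosure E = E ↔ ∀ F : Submodule D K, F ≠ ⊥ → F.FG → F ≤ E → vClosure F ≤ E :=
  ⟨fun h _ h0 hF hFE => (vClosure_le_tClosure h0 hF hFE).trans_eq h,
    fun h => le_antisymm (iSup_le fun F => h F.1 F.2.1 F.2.2.1 F.2.2.2) (le_tClosure E)⟩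

theorem tClosure_bot : tClosure (⊥ : Submodule D K) = ⊥ :=
  tClosure_eq_self_iff.2 fun _ h0 _ hF => absurd (le_bot_iff.1 hF) h0

theorem tClosure_one : tClosure (1 : Submodule D K) = 1 :=
  tClosure_eq_self_iff.2 fun _ _ _ hF => (vClosure_mono hF).trans vClosure_one.le

theorem mul_vClosure_le_of_tClosure_eq_self {A E F : Submodule D K} (hE : tClosure E = E)
    (hA : A.FG) (h0 : F ≠ ⊥) (hF : F.FG) (h : A * F ≤ E) : A * vClosure F ≤ E := by
  obtain rfl | hA0 := eq_or_ne A ⊥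
  · rw [Submodule.bot_mul]
    exact bot_le
  · exact (mul_vClosure_le A F).trans
      (tClosure_eq_self_iff.1 hE _ (mul_ne_zero hA0 h0) (hA.mul hF) h)

theorem exists_fg_le_mul {A I F : Submodule D K} (hF : F.FG) (h : F ≤ A * I) :
    ∃ G ≤ I, G.FG ∧ F ≤ A * G := by
  have hI : ⨆ x : I, Submodule.span D {(x : K)} = I := by
    rw [← Submodule.span_range_eq_iSup, Subtype.range_coe, Submodule.span_eq]
  rw [← hI, Submodule.mul_iSup] at h
  obtain ⟨s, hs⟩ :=
    CompleteLattice.IsCompactElement.exists_finset_of_le_iSup _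
      ((Submodule.fg_iff_compact F).1 hF) _ h
  simp only [← Submodule.mul_iSup] at hs
  exact ⟨⨆ x ∈ s, Submodule.span D {(x : K)},
    iSup₂_le fun x _ => (Submodule.span_singleton_le_iff_mem _ _).2 x.2,
    Submodule.fg_biSup s _ fun _ _ => Submodule.fg_span_singleton _, hs⟩

theorem span_algebraMap_mul_le_iff {d : D} {E F : Submodule D K} :
    Submodule.span D {algebraMap D K d} * E ≤ F ↔ ∀ e ∈ E, d • e ∈ F := by
  simp only [Submodule.span_singleton_mul, SetLike.le_def, Submodule.mem_smul_pointwise_iff_exists,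
    forall_exists_index, and_imp, forall_apply_eq_imp_iff₂, smul_eq_mul, Algebra.smul_def d]

theorem coeSubmodule_le_one (I : Ideal D) : coeSubmodule K I ≤ 1 := by
  rw [← IsLocalization.coeSubmodule_top K]
  exact IsLocalization.coeSubmodule_mono K le_top

theorem vClosure_coeSubmodule_le_one (I : Ideal D) : vClosure (coeSubmodule K I) ≤ 1 :=
  (vClosure_mono (coeSubmodule_le_one I)).trans_eq vClosure_one

theorem exists_coeSubmodule_eq {E : Submodule D K} (hE : E ≤ 1) :
    ∃ I : Ideal D, coeSubmodule K I = E := by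
  refine ⟨E.comap (Algebra.linearMap D K), ?_⟩
  rw [coeSubmodule, Submodule.map_comap_eq, inf_eq_right]
  rwa [Submodule.one_eq_range] at hE

/-- The ideal of all `d ∈ D` with `d uⁿ ∈ A` for every `n`. When `A` is a valuation ring of `K` and
`u ∉ A`, it is the contraction to `D` of the largest prime of `A` not containing `u⁻¹`. -/
def powConductor (A : Subalgebra D K) (u : K) : Ideal D :=
  ⨅ n : ℕ, A.toSubmodule.comap (LinearMap.toSpanSingleton D K (u ^ n))

theorem mem_powConductor {A : Subalgebra D K} {u : K} {d : D} :
    d ∈ powConductor A u ↔ ∀ n : ℕ, d • u ^ n ∈ A := by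
  simp only [powConductor, Submodule.mem_iInf, Submodule.mem_comap,
    LinearMap.toSpanSingleton_apply, Subalgebra.mem_toSubmodule]

theorem mem_powConductor_of_mem_vClosure {A : Subalgebra D K} {E : Submodule D K} {u : K}
    (hu : ∀ n : ℕ, u ^ n ∈ 1 / E) {d : D} (hd : algebraMap D K d ∈ vClosure E) :
    d ∈ powConductor A u := by
  refine mem_powConductor.2 fun n => ?_
  obtain ⟨a, ha⟩ := Submodule.mem_one.1 (Submodule.mem_div_iff_forall_mul_mem.1 hd _ (hu n))
  rw [Algebra.smul_def, ← ha]
  exact A.algebraMap_mem a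

theorem isPrime_powConductor {A : Subalgebra D K} (hA : ∀ x, x ∈ A ∨ x⁻¹ ∈ A) {u : K}
    (hu : u ∉ A) : (powConductor A u).IsPrime := by
  refine ⟨?_, fun {a b} hab => ?_⟩
  · rw [Ideal.ne_top_iff_one, mem_powConductor]
    exact fun h => hu (by simpa only [one_smul, pow_one] using h 1)
  · by_contra! hcon
    simp only [mem_powConductor, not_forall] at hcon hab
    obtain ⟨⟨n, hn⟩, m, hm⟩ := hcon
    have hb : b • u ^ m ≠ 0 := fun h => hm (h ▸ zero_mem A)
    have hprod : (a * b) • u ^ (n + m) * (b • u ^ m)⁻¹ = a • u ^ n := by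
      rw [mul_inv_eq_iff_eq_mul₀ hb, smul_mul_smul_comm, pow_add]
    exact hn (hprod ▸ mul_mem (hab (n + m)) ((hA _).resolve_left hm))

theorem localizationAt_anti {P Q : Ideal D} (h : P ≤ Q) :
    localizationAt K Q ⊆ localizationAt K P := by
  rintro x ⟨a, s, hs, rfl⟩
  exact ⟨a, s, fun hsP => hs (h hsP), rfl⟩

variable [IsFractionRing D K]

theorem algebraMap_mem_coeSubmodule {I : Ideal D} {d : D} :
    algebraMap D K d ∈ coeSubmodule K I ↔ d ∈ I :=
  (IsLocalization.mem_coeSubmodule K I).trans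
    (IsFractionRing.injective D K).mem_set_image

theorem coeSubmodule_ne_bot {I : Ideal D} : coeSubmodule K I ≠ ⊥ ↔ I ≠ ⊥ := by
  rw [← IsLocalization.coeSubmodule_bot K, (IsFractionRing.coeSubmodule_injective D K).ne_iff]

theorem coeSubmodule_fg {I : Ideal D} : (coeSubmodule K I).FG ↔ I.FG :=
  IsLocalization.coeSubmodule_fg K (IsFractionRing.injective D K) I

theorem isTIdeal_iff {I : Ideal D} : IsTIdeal K I ↔ I ≠ ⊥ ∧
    ∀ J : Ideal D, J ≠ ⊥ → J.FG → J ≤ I → vClosure (coeSubmodule K J) ≤ coeSubmodule K I := by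
  refine and_congr_right fun _ => tClosure_eq_self_iff.trans ⟨fun h J h0 hJ hJI => ?_,
    fun h F h0 hF hFI => ?_⟩
  · exact h _ (coeSubmodule_ne_bot.2 h0) (coeSubmodule_fg.2 hJ)
      (IsLocalization.coeSubmodule_mono K hJI)
  · obtain ⟨J, rfl⟩ := exists_coeSubmodule_eq (hFI.trans (coeSubmodule_le_one I))
    exact h J (coeSubmodule_ne_bot.1 h0) (coeSubmodule_fg.1 hF)
      (IsFractionRing.coeSubmodule_le_coeSubmodule.1 hFI)

theorem comap_toSpanSingleton_ne_bot {E : Submodule D K} (hE : E ≠ ⊥) (y : K) :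
    E.comap (LinearMap.toSpanSingleton D K y) ≠ ⊥ := by
  obtain ⟨e, he, he0⟩ := Submodule.exists_mem_ne_zero_of_ne_bot hE
  obtain ⟨a, b, hb, rfl⟩ := IsFractionRing.div_surjective (A := D) y
  obtain ⟨c, d, hd, rfl⟩ := IsFractionRing.div_surjective (A := D) e
  have := (algebraMap D K).domain_nontrivial
  have hb0 : algebraMap D K b ≠ 0 := IsFractionRing.to_map_ne_zero_of_mem_nonZeroDivisors hb
  have hd0 : algebraMap D K d ≠ 0 := IsFractionRing.to_map_ne_zero_of_mem_nonZeroDivisors hd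
  have hc0 : algebraMap D K c ≠ 0 := (div_ne_zero_iff.1 he0).1
  have hsmul : (b * c) • (algebraMap D K a / algebraMap D K b) =
      (a * d) • (algebraMap D K c / algebraMap D K d) := by
    simp only [Algebra.smul_def, map_mul]
    field_simp
  refine (Submodule.ne_bot_iff _).2 ⟨b * c, ?_, fun h => mul_ne_zero hb0 hc0 ?_⟩
  · rw [Submodule.mem_comap, LinearMap.toSpanSingleton_apply, hsmul]
    exact E.smul_mem _ he
  · rw [← map_mul, h, map_zero]

theorem isTIdeal_comap_toSpanSingleton {E : Submodule D K} (hE0 : E ≠ ⊥) (hE : tClosure E = E)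
    (y : K) : IsTIdeal K (E.comap (LinearMap.toSpanSingleton D K y)) := by
  refine isTIdeal_iff.2 ⟨comap_toSpanSingleton_ne_bot hE0 y, fun J h0 hJ hJE z hz => ?_⟩
  have hyJ : Submodule.span D {y} * coeSubmodule K J ≤ E := by
    rw [Submodule.span_singleton_mul]
    rintro _ ⟨_, ⟨j, hj, rfl⟩, rfl⟩
    have hjy : j • y ∈ E := hJE hj
    rwa [Algebra.smul_def, mul_comm] at hjy
  obtain ⟨d, rfl⟩ := Submodule.mem_one.1 (vClosure_coeSubmodule_le_one J hz)
  rw [algebraMap_mem_coeSubmodule, Submodule.mem_comap, LinearMap.toSpanSingleton_apply,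
    Algebra.smul_def, mul_comm]
  exact mul_vClosure_le_of_tClosure_eq_self hE (Submodule.fg_span_singleton y)
    (coeSubmodule_ne_bot.2 h0) (coeSubmodule_fg.2 hJ) hyJ
    (Submodule.mul_mem_mul (Submodule.mem_span_singleton_self y) hz)

theorem IsTIdeal.exists_le_isTMaximal {I : Ideal D} (hI : IsTIdeal K I) (hne : I ≠ ⊤) :
    ∃ M, I ≤ M ∧ IsTMaximal K M := by
  refine zorn_le_nonempty₀ {I : Ideal D | I ≠ ⊤ ∧ IsTIdeal K I} ?_ I ⟨hne, hI⟩
  intro c hc hchain L hL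
  have hdir : DirectedOn (· ≤ ·) c := hchain.directedOn
  refine ⟨sSup c, ⟨?_, isTIdeal_iff.2 ⟨?_, fun J h0 hJ hJc => ?_⟩⟩, fun _ => le_sSup⟩
  · rw [Ideal.ne_top_iff_one, Submodule.mem_sSup_of_directed ⟨L, hL⟩ hdir]
    rintro ⟨N, hN, h1⟩
    exact (hc hN).1 ((Ideal.eq_top_iff_one N).2 h1)
  · exact ne_bot_of_le_ne_bot (hc hL).2.1 (le_sSup hL)
  · obtain ⟨N, hN, hJN⟩ :=
      (Submodule.fg_iff_compact J).1 hJ c _ ⟨L, hL⟩ hdir (isLUB_sSup c) hJc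
    exact ((isTIdeal_iff.1 (hc hN).2).2 J h0 hJ hJN).trans
      (IsLocalization.coeSubmodule_mono K (le_sSup hN))

theorem IsTMaximal.isTPrime {M : Ideal D} (hM : IsTMaximal K M) : IsTPrime K M := by
  refine ⟨⟨hM.1.1, fun {a b} hab => or_iff_not_imp_right.2 fun hb => ?_⟩, hM.1.2⟩
  set C := (coeSubmodule K M).comap (LinearMap.toSpanSingleton D K (algebraMap D K b))
  have mem_C (d : D) : d ∈ C ↔ d * b ∈ M := by
    rw [Submodule.mem_comap, LinearMap.toSpanSingleton_apply, Algebra.smul_def, ← map_mul,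
      algebraMap_mem_coeSubmodule]
  have hC : IsTIdeal K C :=
    isTIdeal_comap_toSpanSingleton (coeSubmodule_ne_bot.2 hM.1.2.1) hM.1.2.2 _
  have hCtop : C ≠ ⊤ := by rwa [Ideal.ne_top_iff_one, mem_C, one_mul]
  have hMC : M ≤ C := fun m hm => (mem_C m).2 (M.mul_mem_right b hm)
  exact hM.2 ⟨hCtop, hC⟩ hMC ((mem_C a).2 hab)

theorem mem_localizationAt_iff {P : Ideal D} {x : K} :
    x ∈ localizationAt K P ↔ ∃ s ∉ P, s • x ∈ (1 : Submodule D K) := by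
  have map_ne_zero {s : D} (hs : s ∉ P) : algebraMap D K s ≠ 0 := fun h =>
    hs ((FaithfulSMul.algebraMap_eq_zero_iff D K).1 h ▸ P.zero_mem)
  constructor
  · rintro ⟨a, s, hs, rfl⟩
    exact ⟨s, hs, Submodule.mem_one.2
      ⟨a, by rw [Algebra.smul_def, mul_div_cancel₀ _ (map_ne_zero hs)]⟩⟩
  · rintro ⟨s, hs, hsx⟩
    obtain ⟨a, ha⟩ := Submodule.mem_one.1 hsx
    exact ⟨a, s, hs, by rw [ha, Algebra.smul_def, mul_div_cancel_left₀ _ (map_ne_zero hs)]⟩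

theorem mem_one_of_forall_mem_localizationAt {y : K}
    (h : ∀ N : Ideal D, IsTMaximal K N → y ∈ localizationAt K N) : y ∈ (1 : Submodule D K) := by
  by_contra hy
  set I := (1 : Submodule D K).comap (LinearMap.toSpanSingleton D K y)
  have hI : IsTIdeal K I := isTIdeal_comap_toSpanSingleton one_ne_zero tClosure_one y
  have hItop : I ≠ ⊤ := by
    rwa [Ideal.ne_top_iff_one, Submodule.mem_comap, LinearMap.toSpanSingleton_apply, one_smul]
  obtain ⟨N, hIN, hN⟩ := hI.exists_le_isTMaximal hItop
  obtain ⟨s, hs, hsy⟩ := mem_localizationAt_iff.1 (h N hN)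
  exact hs (hIN hsy)

theorem mem_localizationAt_of_mem_one_div {J P : Ideal D} (hJP : ¬ J ≤ P) {u : K}
    (hu : u ∈ 1 / coeSubmodule K J) : u ∈ localizationAt K P := by
  obtain ⟨j, hj, hjP⟩ := SetLike.not_le_iff_exists.1 hJP
  refine mem_localizationAt_iff.2 ⟨j, hjP, ?_⟩
  rw [Algebra.smul_def, mul_comm]
  exact Submodule.mem_div_iff_forall_mul_mem.1 hu _ (algebraMap_mem_coeSubmodule.2 hj)

theorem mem_localizationAt_of_smul_mem {P : Ideal D} [P.IsPrime] {s : D} (hs : s ∉ P) {x : K}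
    (hsx : s • x ∈ localizationAt K P) : x ∈ localizationAt K P := by
  obtain ⟨t, ht, htsx⟩ := mem_localizationAt_iff.1 hsx
  exact mem_localizationAt_iff.2 ⟨t * s, ‹P.IsPrime›.mul_notMem ht hs, by rwa [mul_smul]⟩

theorem mem_of_smul_eq_algebraMap {P : Ideal D} [P.IsPrime] {p s : D} (hp : p ∈ P) {x : K}
    (hx : x ∈ localizationAt K P) (h : p • x = algebraMap D K s) : s ∈ P := by
  obtain ⟨t, ht, htx⟩ := mem_localizationAt_iff.1 hx
  obtain ⟨a, ha⟩ := Submodule.mem_one.1 htx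
  have hts : t * s = p * a := by
    apply IsFractionRing.injective D K
    rw [map_mul, map_mul, ← h, ha, Algebra.smul_def, Algebra.smul_def]
    ring
  exact (‹P.IsPrime›.mem_or_mem (hts ▸ P.mul_mem_right a hp)).resolve_left ht

theorem IsPvMD.tClosure_mul_one_div (hD : IsPvMD D K) {E : Submodule D K} (h0 : E ≠ ⊥)
    (hE : E.FG) : tClosure (E * (1 / E)) = 1 := by
  refine le_antisymm ((tClosure_mono Submodule.mul_one_div_le_one).trans_eq tClosure_one) ?_
  obtain ⟨d, hd, hdE⟩ := FractionalIdeal.isFractional_of_fg (S := nonZeroDivisors D) hE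
  have := (algebraMap D K).domain_nontrivial
  have hd0 : algebraMap D K d ≠ 0 := IsFractionRing.to_map_ne_zero_of_mem_nonZeroDivisors hd
  set C := Submodule.span D {algebraMap D K d}
  have hC0 : C ≠ ⊥ := by rwa [Ne, Submodule.span_singleton_eq_bot]
  have hCE : C * E ≤ 1 :=
    span_algebraMap_mul_le_iff.2 fun e he => Submodule.mem_one.2 (hdE e he)
  obtain ⟨J, hJ⟩ := exists_coeSubmodule_eq hCE
  have hJ0 : J ≠ ⊥ := coeSubmodule_ne_bot.1 (hJ ▸ mul_ne_zero hC0 h0)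
  have hJfg : J.FG := coeSubmodule_fg.1 (hJ ▸ (Submodule.fg_span_singleton _).mul hE)
  refine (hD J hJ0 hJfg).ge.trans (tClosure_mono ?_)
  rw [hJ]
  calc C * E * (1 / (C * E)) = C * (1 / (C * E)) * E := mul_right_comm _ _ _
    _ ≤ 1 / E * E := mul_le_mul_left (mul_one_div_mul_le C E) _
    _ = E * (1 / E) := mul_comm _ _

theorem IsPvMD.exists_mul_notMem (hD : IsPvMD D K) {S : Set K} {E : Submodule D K}
    (hSE : Submodule.span D S = E) (h0 : E ≠ ⊥) (hE : E.FG) {M : Ideal D} (hM : IsTIdeal K M)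
    (hMtop : M ≠ ⊤) : ∃ g ∈ S, ∃ u ∈ 1 / E, ∃ s ∉ M, u * g = algebraMap D K s := by
  by_contra! hcon
  have hle : E * (1 / E) ≤ coeSubmodule K M := by
    rw [← Submodule.le_div_iff_mul_le]
    refine hSE.ge.trans (Submodule.span_le.2 ?_)
    refine fun g hg => Submodule.mem_div_iff_forall_mul_mem.2 fun u hu => ?_
    obtain ⟨s, hs⟩ := Submodule.mem_one.1
      (Submodule.mem_div_iff_forall_mul_mem.1 hu g (hSE ▸ Submodule.subset_span hg))
    rw [mul_comm, ← hs, algebraMap_mem_coeSubmodule]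
    by_contra hsM
    exact hcon g hg u hu s hsM hs.symm
  have hone : (1 : Submodule D K) ≤ coeSubmodule K M :=
    (hD.tClosure_mul_one_div h0 hE).ge.trans ((tClosure_mono hle).trans hM.2.le)
  rw [← IsLocalization.coeSubmodule_top K, IsFractionRing.coeSubmodule_le_coeSubmodule] at hone
  exact hMtop (top_le_iff.1 hone)

theorem IsPvMD.exists_smul_notMem (hD : IsPvMD D K) {J : Ideal D} (h0 : J ≠ ⊥) (hJ : J.FG)
    {M : Ideal D} (hM : IsTIdeal K M) (hMtop : M ≠ ⊤) :
    ∃ g ∈ J, ∃ u ∈ 1 / coeSubmodule K J, ∃ s ∉ M, g • u = algebraMap D K s := by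
  obtain ⟨_, ⟨g, hg, rfl⟩, u, hu, s, hs, hug⟩ := hD.exists_mul_notMem (Submodule.span_eq _)
    (coeSubmodule_ne_bot.2 h0) (coeSubmodule_fg.2 hJ) hM hMtop
  refine ⟨g, hg, u, hu, s, hs, ?_⟩
  rw [Algebra.smul_def, mul_comm]
  exact hug

theorem IsPvMD.exists_fg_le_one_div (hD : IsPvMD D K) {E : Submodule D K}
    (h0 : E ≠ ⊥) (hE : E.FG) :
    ∃ G ≤ 1 / E, G ≠ ⊥ ∧ G.FG ∧ (1 : K) ∈ vClosure (E * G) := by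
  have hone : (1 : K) ∈ tClosure (E * (1 / E)) :=
    (hD.tClosure_mul_one_div h0 hE).ge (Submodule.one_le.1 le_rfl)
  have hne : E * (1 / E) ≠ ⊥ := fun h => by
    rw [h, tClosure_bot] at hone
    exact one_ne_zero ((Submodule.mem_bot D).1 hone)
  obtain ⟨F, hF0, hF, hFE, hF1⟩ := (mem_tClosure_iff hne 1).1 hone
  obtain ⟨G, hGE, hG, hFG⟩ := exists_fg_le_mul hF hFE
  refine ⟨G, hGE, ?_, hG, vClosure_mono hFG hF1⟩
  rintro rfl
  exact hF0 (le_bot_iff.1 (hFG.trans_eq (Submodule.mul_bot E)))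

theorem IsPvMD.mem_or_inv_mem_localizationAt (hD : IsPvMD D K) {M : Ideal D} (hM : IsTIdeal K M)
    (hMtop : M ≠ ⊤) (y : K) : y ∈ localizationAt K M ∨ y⁻¹ ∈ localizationAt K M := by
  have h0 : Submodule.span D {1, y} ≠ ⊥ :=
    (Submodule.ne_bot_iff _).2 ⟨1, Submodule.subset_span (Set.mem_insert 1 _), one_ne_zero⟩
  obtain ⟨g, hg, u, hu, s, hs, hug⟩ :=
    hD.exists_mul_notMem rfl h0 (Submodule.fg_span (Set.toFinite _)) hM hMtop
  have hu1 : u ∈ (1 : Submodule D K) :=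
    one_div_le_one (Submodule.subset_span (Set.mem_insert 1 _)) hu
  have huy : u * y ∈ (1 : Submodule D K) := Submodule.mem_div_iff_forall_mul_mem.1 hu y
    (Submodule.subset_span (Set.mem_insert_of_mem 1 rfl))
  obtain rfl | rfl := hg
  · refine Or.inl (mem_localizationAt_iff.2 ⟨s, hs, ?_⟩)
    rwa [Algebra.smul_def, ← hug, mul_one]
  · refine Or.inr (mem_localizationAt_iff.2 ⟨s, hs, ?_⟩)
    rw [Algebra.smul_def, ← hug]
    obtain rfl | hy0 := eq_or_ne g 0
    · rw [inv_zero, mul_zero]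
      exact zero_mem _
    · rwa [mul_inv_cancel_right₀ hy0]

theorem IsPvMD.isTPrime_of_le (hD : IsPvMD D K) {M Q : Ideal D} (hM : IsTIdeal K M)
    (hMtop : M ≠ ⊤) (hQ : Q.IsPrime) (h0 : Q ≠ ⊥) (hQM : Q ≤ M) : IsTPrime K Q := by
  refine ⟨hQ, isTIdeal_iff.2 ⟨h0, fun J hJ0 hJ hJQ z hz => ?_⟩⟩
  obtain ⟨d, rfl⟩ := Submodule.mem_one.1 (vClosure_coeSubmodule_le_one J hz)
  obtain ⟨g, hg, u, hu, s, hs, hug⟩ := hD.exists_smul_notMem hJ0 hJ hM hMtop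
  obtain ⟨c, hc⟩ := Submodule.mem_one.1 (Submodule.mem_div_iff_forall_mul_mem.1 hz u hu)
  have hds : d * s = c * g := by
    apply IsFractionRing.injective D K
    rw [map_mul, map_mul, ← hug, hc, Algebra.smul_def]
    ring
  have hdsQ : d * s ∈ Q := hds ▸ Q.mul_mem_left c (hJQ hg)
  exact algebraMap_mem_coeSubmodule.2
    ((hQ.mem_or_mem hdsQ).resolve_right fun hsQ => hs (hQM hsQ))

theorem IsTIdeal.mem_of_one_mem_vClosure_mul {N : Ideal D} (hN : IsTIdeal K N)
    {E F : Submodule D K} (h0 : E * F ≠ ⊥) (hEF : (E * F).FG) (hFN : F ≤ coeSubmodule K N)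
    (hone : (1 : K) ∈ vClosure (E * F)) {s : D} (hs : ∀ e ∈ E, s • e ∈ (1 : Submodule D K)) :
    s ∈ N := by
  set C := Submodule.span D {algebraMap D K s}
  have hCE : C * E ≤ 1 := span_algebraMap_mul_le_iff.2 hs
  have hCEF : C * (E * F) ≤ coeSubmodule K N :=
    calc C * (E * F) = C * E * F := (mul_assoc _ _ _).symm
      _ ≤ 1 * F := mul_le_mul_left hCE _
      _ = F := one_mul _
      _ ≤ coeSubmodule K N := hFN
  have hsN : algebraMap D K s * 1 ∈ coeSubmodule K N :=
    mul_vClosure_le_of_tClosure_eq_self hN.2 (Submodule.fg_span_singleton _) h0 hEF hCEF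
      (Submodule.mul_mem_mul (Submodule.mem_span_singleton_self _) hone)
  rwa [mul_one, algebraMap_mem_coeSubmodule] at hsN

theorem IsPvMD.exists_fg_of_isTSharp (hD : IsPvMD D K) {Q : Ideal D} (hQ : IsTSharp K Q) :
    ∃ G ≤ Q, G.FG ∧ ∀ N, IsTMaximal K N → G ≤ N → Q ≤ N := by
  obtain ⟨u, huΘ, huQ⟩ := Set.not_subset.1 hQ
  set E := Submodule.span D {1, u}
  have h1E : 1 ∈ E := Submodule.subset_span (Set.mem_insert 1 _)
  have huE : u ∈ E := Submodule.subset_span (Set.mem_insert_of_mem 1 rfl)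
  have hE0 : E ≠ ⊥ := (Submodule.ne_bot_iff _).2 ⟨1, h1E, one_ne_zero⟩
  have hE : E.FG := Submodule.fg_span (Set.toFinite _)
  obtain ⟨F, hFE, hF0, hF, hone⟩ := hD.exists_fg_le_one_div hE0 hE
  obtain ⟨G, rfl⟩ := exists_coeSubmodule_eq (hFE.trans (one_div_le_one h1E))
  refine ⟨G, fun g hg => ?_, coeSubmodule_fg.1 hF, fun N hN hGN => ?_⟩
  · by_contra hgQ
    refine huQ (mem_localizationAt_iff.2 ⟨g, hgQ, ?_⟩)
    rw [Algebra.smul_def]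
    exact Submodule.mem_div_iff_forall_mul_mem.1 (hFE (algebraMap_mem_coeSubmodule.2 hg)) u huE
  · by_contra hQN
    obtain ⟨s, hs, hsu⟩ := mem_localizationAt_iff.1 (Set.mem_iInter₂.1 huΘ N ⟨hN, hQN⟩)
    refine hs (hN.1.2.mem_of_one_mem_vClosure_mul (mul_ne_zero hE0 hF0) (hE.mul hF)
      (IsLocalization.coeSubmodule_mono K hGN) hone fun e he => ?_)
    obtain ⟨a, b, rfl⟩ := Submodule.mem_span_pair.1 he
    rw [smul_add, smul_comm s a, smul_comm s b]
    exact add_mem (Submodule.smul_mem _ a (Submodule.smul_mem _ s (Submodule.one_le.1 le_rfl)))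
      (Submodule.smul_mem _ b hsu)

variable [IsDomain D]

variable (K) in
/-- The localization `D_P` as a subalgebra of `K`, with carrier `localizationAt K P`. -/
noncomputable def localizationSubalgebra (P : Ideal D) [P.IsPrime] : Subalgebra D K :=
  (Localization.subalgebra.ofField K P.primeCompl P.primeCompl_le_nonZeroDivisors).copy
    (localizationAt K P) (localizationAt_eq K P)

theorem mem_localizationSubalgebra {P : Ideal D} [P.IsPrime] {x : K} :
    x ∈ localizationSubalgebra K P ↔ x ∈ localizationAt K P :=
  Iff.rfl

theorem smul_mem_localizationAt_of_le {P N : Ideal D} [P.IsPrime] [N.IsPrime] (hPN : P ≤ N)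
    (hN : ∀ y : K, y ∈ localizationAt K N ∨ y⁻¹ ∈ localizationAt K N) {p : D} (hp : p ∈ P) {x : K}
    (hx : x ∈ localizationAt K P) : p • x ∈ localizationAt K N := by
  by_contra hpx
  have hpx0 : p • x ≠ 0 := fun h => hpx (h ▸ zero_mem (localizationSubalgebra K N))
  have hinv : (p • x)⁻¹ ∈ localizationAt K P := localizationAt_anti hPN ((hN _).resolve_left hpx)
  refine Ideal.IsPrime.one_notMem ‹_› (mem_of_smul_eq_algebraMap hp
    (mul_mem (S := Subalgebra D K) (s := localizationSubalgebra K P) hx hinv) ?_)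
  rw [← smul_mul_assoc, mul_inv_cancel₀ hpx0, map_one]

theorem pow_mem_tTheta {P : Ideal D} {u : K} (hu : u ∈ tTheta K P) (n : ℕ) :
    u ^ n ∈ tTheta K P := by
  refine Set.mem_iInter₂.2 fun N hN => ?_
  have := hN.1.isTPrime.1
  exact pow_mem (S := localizationSubalgebra K N) (Set.mem_iInter₂.1 hu N hN) n

theorem IsPvMD.localizationAt_inter_tTheta_subset_one_div (hD : IsPvMD D K) {P : Ideal D}
    [P.IsPrime] : localizationAt K P ∩ tTheta K P ⊆ (1 / coeSubmodule K P : Submodule D K) := by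
  rintro u ⟨huP, huΘ⟩
  refine Submodule.mem_div_iff_forall_mul_mem.2 ?_
  rintro _ ⟨p, hp, rfl⟩
  refine mem_one_of_forall_mem_localizationAt fun N hN => ?_
  have := hN.isTPrime.1
  rw [Algebra.linearMap_apply, mul_comm, ← Algebra.smul_def]
  by_cases hPN : P ≤ N
  · exact smul_mem_localizationAt_of_le hPN (hD.mem_or_inv_mem_localizationAt hN.1.2 hN.1.1) hp huP
  · exact (localizationSubalgebra K N).smul_mem (Set.mem_iInter₂.1 huΘ N ⟨hN, hPN⟩) p

theorem IsPvMD.pow_mem_one_div (hD : IsPvMD D K) {P J : Ideal D} [P.IsPrime] (hJP : ¬ J ≤ P)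
    (hJ : ∀ N, IsTMaximal K N → J ≤ N → P ≤ N) {u : K} (hu : u ∈ 1 / coeSubmodule K J) (n : ℕ) :
    u ^ n ∈ 1 / coeSubmodule K P := by
  have huΘ : u ∈ tTheta K P := Set.mem_iInter₂.2 fun N hN =>
    mem_localizationAt_of_mem_one_div (fun hJN => hN.2 (hJ N hN.1 hJN)) hu
  exact hD.localizationAt_inter_tTheta_subset_one_div
    ⟨pow_mem (S := localizationSubalgebra K P) (mem_localizationAt_of_mem_one_div hJP hu) n,
      pow_mem_tTheta huΘ n⟩

theorem not_le_powConductor_of_mem_minimalPrimes {I Q : Ideal D} [Q.IsPrime]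
    (hQ : Q ∈ I.minimalPrimes) (hV : ∀ y : K, y ∈ localizationAt K Q ∨ y⁻¹ ∈ localizationAt K Q)
    {g s : D} {u : K} (hg : g ∈ Q) (hs : s ∉ Q) (hgu : g • u = algebraMap D K s) :
    ¬ I ≤ powConductor (localizationSubalgebra K Q) u := by
  intro hI
  have hu : u ∉ localizationAt K Q := fun hu => hs (mem_of_smul_eq_algebraMap hg hu hgu)
  have hRQ : powConductor (localizationSubalgebra K Q) u ≤ Q := fun d hd => by
    by_contra hdQ
    refine hu (mem_localizationAt_of_smul_mem hdQ ?_)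
    rw [← pow_one u, ← mem_localizationSubalgebra]
    exact mem_powConductor.1 hd 1
  have hgR := hQ.2 ⟨isPrime_powConductor hV hu, hI⟩ hRQ hg
  refine hu (mem_localizationAt_of_smul_mem hs ?_)
  rw [Algebra.smul_def, ← hgu, smul_mul_assoc, ← pow_two]
  exact mem_powConductor.1 hgR 2

theorem IsPvMD.notMem_vClosure (hD : IsPvMD D K) {P M : Ideal D} [P.IsPrime] (hP0 : P ≠ ⊥)
    (hM : IsTPrime K M) (hPM : P ≤ M)
    (hsharp : ∀ Q, IsTPrime K Q → P < Q → Q ≤ M → IsTSharp K Q) {x : D} (hxM : x ∈ M)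
    (hxP : x ∉ P) : algebraMap D K x ∉ vClosure (coeSubmodule K P) := by
  intro hx
  have := hM.1
  obtain ⟨Q, hQ, hQM⟩ := Ideal.exists_minimalPrimes_le (I := P ⊔ Ideal.span {x}) (J := M)
    (sup_le hPM ((Ideal.span_singleton_le_iff_mem M).2 hxM))
  have := hQ.1.1
  have hPQ : P ≤ Q := le_sup_left.trans hQ.1.2
  have hxQ : Ideal.span {x} ≤ Q := le_sup_right.trans hQ.1.2
  have hQt : IsTPrime K Q :=
    hD.isTPrime_of_le hM.2 hM.1.ne_top this (ne_bot_of_le_ne_bot hP0 hPQ) hQM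
  have hPltQ : P < Q := hPQ.lt_of_not_ge fun h => hxP (h (hxQ (Ideal.mem_span_singleton_self x)))
  obtain ⟨G, hGQ, hG, hGN⟩ := hD.exists_fg_of_isTSharp (hsharp Q hQt hPltQ hQM)
  have hJP : ¬ G ⊔ Ideal.span {x} ≤ P := fun h =>
    hxP (h (Ideal.mem_sup_right (Ideal.mem_span_singleton_self x)))
  obtain ⟨g, hg, u, hu, s, hs, hgu⟩ := hD.exists_smul_notMem (fun h => hJP (h.trans_le bot_le))
    (Submodule.FG.sup hG (Submodule.fg_span_singleton x)) hQt.2 hQt.1.ne_top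
  have hupow := hD.pow_mem_one_div hJP
    (fun N hN hJN => hPQ.trans (hGN N hN (le_sup_left.trans hJN))) hu
  have hPR : P ≤ powConductor (localizationSubalgebra K Q) u := fun p hp =>
    mem_powConductor_of_mem_vClosure hupow (le_vClosure _ (algebraMap_mem_coeSubmodule.2 hp))
  have hxR : x ∈ powConductor (localizationSubalgebra K Q) u :=
    mem_powConductor_of_mem_vClosure hupow hx
  exact not_le_powConductor_of_mem_minimalPrimes hQ
    (hD.mem_or_inv_mem_localizationAt hQt.2 hQt.1.ne_top) (sup_le hGQ hxQ hg) hs hgu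
    (sup_le hPR ((Ideal.span_singleton_le_iff_mem _).2 hxR))

end TOperation

open TOperation in
theorem mainTheorem10_general {D : Type*} [CommRing D] [IsDomain D] (K : Type*) [Field K]
    [Algebra D K] [IsFractionRing D K] (hD : IsPvMD D K) {P M : Ideal D} [P.IsPrime] (hP0 : P ≠ ⊥)
    (hM : IsTPrime K M) (hPM : P < M)
    (hsharp : ∀ Q, IsTPrime K Q → P < Q → Q ≤ M → IsTSharp K Q) : IsDivisorial K P := by
  refine ⟨hP0, le_antisymm (fun z hz => ?_) (le_vClosure _)⟩
  obtain ⟨y, rfl⟩ := Submodule.mem_one.1 (vClosure_coeSubmodule_le_one P hz)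
  rw [algebraMap_mem_coeSubmodule]
  by_contra hyP
  obtain ⟨m, hmM, hmP⟩ := SetLike.exists_of_lt hPM
  refine hD.notMem_vClosure hP0 hM hPM.le hsharp (M.mul_mem_right y hmM)
    (Ideal.IsPrime.mul_notMem ‹_› hmP hyP) ?_
  rw [map_mul, ← Algebra.smul_def]
  exact Submodule.smul_mem _ m hz

theorem mainTheorem10 {D : Type*} [CommRing D] [IsDomain D] (K : Type*) [Field K] [Algebra D K]
    [IsFractionRing D K] (hD : TOperation.IsPvMD D K) (hsharp : TOperation.IsTDoublesharp D K)
    (P : Ideal D) (hP : TOperation.IsTPrime K P) (hmax : ¬ TOperation.IsTMaximal K P) :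
    TOperation.IsDivisorial K P := by
  obtain ⟨M, hPM, hM⟩ := hP.2.exists_le_isTMaximal hP.1.ne_top
  have := hP.1
  exact mainTheorem10_general K hD hP.2.1 hM.isTPrime
    (hPM.lt_of_ne fun h => hmax (h ▸ hM)) fun Q hQ _ _ => hsharp Q hQ
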